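/- Fix $\rho > 0$, integers $M \geq N \geq 1$, and real scalars $c_0, \ldots, c_{N-1} > 0$. Let $\mathcal{P}_N(\overline{D}(0,\rho))$ denote the set of complex positive semidefinite $N \times N$ matrices all of whose entries have modulus at most $\rho$. For such a matrix $A = (a_{ij})$ and an integer $k \geq 0$, let $A^{\circ k} := (a_{ij}^k)$ be its Hadamard (entrywise) power, where $A^{\circ 0} := \mathbf{1}_{N \times N}$ is the matrix with all entries equal to one. Set $$\mathcal{C}(\mathbf{c}; z^M; N, \rho) := \sum_{j=0}^{N-1} \binom{M}{j}^2 \binom{M-j-1}{N-j-1}^2 \frac{\rho^{M-j}}{c_j}.$$ Then $$A^{\circ M} \leq \mathcal{C}(\mathbf{c}; z^M; N, \rho) \cdot \bigl( c_0 \mathbf{1}_{N \times N} + c_1 A + \cdots + c_{N-1} A^{\circ (N-1)} \bigr) \qquad \text{for all } A \in \mathcal{P}_N(\overline{D}(0,\rho)),$$ where $\leq$ is the Loewner ordering ($X \leq Y$ means that $Y - X$ is positive semidefinite). Moreover, the constant is sharp: if $t \in \mathbb{R}$ is such that $A^{\circ M} \leq t \cdot \bigl( c_0 \mathbf{1}_{N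 \times N} + c_1 A + \cdots + c_{N-1} A^{\circ (N-1)} \bigr)$ for all $A \in \mathcal{P}_N(\overline{D}(0,\rho))$, then $t \geq \mathcal{C}(\mathbf{c}; z^M; N, \rho)$. -/

import Mathlib

open scoped MatrixOrder ComplexOrder

/-- The set of positive semidefinite complex `N × N` matrices all of whose entries lie in `I`
(no restriction on the rank). -/
def psdMatrices (N : ℕ) (I : Set ℂ) : Set (Matrix (Fin N) (Fin N) ℂ) :=
  {A | A.PosSemidef ∧ ∀ i j, A i j ∈ I}

/-- The Hadamard (entrywise) power `A^{∘k}`. As `0 ^ 0 = 1`, the power `A^{∘0}` is the matrix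
with all entries equal to one. -/
def hadamardPower {N : ℕ} (A : Matrix (Fin N) (Fin N) ℂ) (k : ℕ) : Matrix (Fin N) (Fin N) ℂ :=
  A.map (fun z => z ^ k)

/-- The linear combination `c_0 𝟏 + c_1 A + ⋯ + c_{N-1} A^{∘(N-1)}` of Hadamard powers of `A`. -/
noncomputable def hadamardCombination {N : ℕ} (c : Fin N → ℝ) (A : Matrix (Fin N) (Fin N) ℂ) :
    Matrix (Fin N) (Fin N) ℂ :=
  ∑ j : Fin N, c j • hadamardPower A (j : ℕ)

/-- The constant
`C(c; z^M; N, ρ) = ∑_{j < N} binom(M, j)² binom(M-j-1, N-j-1)² ρ^{M-j} / c_j`.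
It is used for `M ≥ N`, where the natural number subtractions are genuine. -/
noncomputable def criticalConstant {N : ℕ} (c : Fin N → ℝ) (M : ℕ) (ρ : ℝ) : ℝ :=
  ∑ j : Fin N, (M.choose (j : ℕ) : ℝ) ^ 2 * ((M - (j : ℕ) - 1).choose (N - (j : ℕ) - 1) : ℝ) ^ 2 *
    (ρ ^ (M - (j : ℕ)) / c j)

/-!
The proof has three ingredients.

*Rank one.* Let `A = u u⋆` with `‖u i‖ ≤ √ρ`, and let `∑ j < N, p j * z ^ j` be the remainder of
`z ^ M` modulo `∏ i, (z - u i)`. Then the vector of `M`-th powers of the `u i` is the combination,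
with coefficients `p j`, of the vectors of `j`-th powers, so by the Cauchy-Schwarz inequality the
optimal constant for `A` is at most `∑ j, ‖p j‖ ^ 2 / c j` (`posSemidef_rankOne`). Up to sign, `p j`
is a hook Schur polynomial in `u`, which has nonnegative coefficients, hence `‖p j‖` is largest when
every `u i` equals `√ρ`; the remainder is then that of `z ^ M` modulo `(z - √ρ) ^ N`, and the sum
becomes the critical constant. Instead of Schur polynomials, the recursion defining `powRem` is
used, which yields both the bound (`norm_coeff_powRem_le`) and the extremal value
(`coeff_powRem_const`).

*Arbitrary rank.* By a method of FitzGerald and Horn, `posSemidef_map_aeval_succ`, a real polynomial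
`f` preserves positivity on matrices of size `N + 1` if it does so on those of rank one and if `f'`
preserves positivity on matrices of size `N`. For `f = K (c₀ + ⋯ + c_N z ^ N) - z ^ (M + 1)` the
derivative has the same shape, and its critical constant is not larger
(`criticalConstant_derivative_le`), so induction on the size applies.

*Sharpness.* For distinct points `u i` the Vandermonde matrix is invertible, so that equality in the
Cauchy-Schwarz inequality is attained, and `∑ j, ‖p j‖ ^ 2 / c j` is optimal for `u u⋆`. Letting the
points tend to `√ρ`, where the coefficients `p j` are continuous, gives the critical constant
(`criticalConstant_le`).
-/

/-! ### Remainders of powers modulo a product of linear factors -/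

section PowerRemainder

open Polynomial

/-- The remainder of `X ^ M` modulo `∏ i < N, (X - x i)`. It is defined by the recursion
`R (N+1) (M+1) = x N • R (N+1) M + (X - x N) * R N M`, which comes from
`X ^ (M+1) = x N • X ^ M + (X - x N) * X ^ M`. -/
noncomputable def powRem {R : Type*} [CommRing R] (x : ℕ → R) : ℕ → ℕ → R[X]
  | 0, _ => 0
  | _ + 1, 0 => 1
  | N + 1, M + 1 => C (x N) * powRem x (N + 1) M + (X - C (x N)) * powRem x N M

lemma degree_powRem_lt {R : Type*} [CommRing R] (x : ℕ → R) (N M : ℕ) :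
    (powRem x N M).degree < N := by
  induction M generalizing N with
  | zero =>
    cases N with
    | zero => simp [powRem]
    | succ N =>
      rw [powRem]
      exact degree_one_le.trans_lt (by exact_mod_cast N.succ_pos)
  | succ M ih =>
    cases N with
    | zero => simp [powRem]
    | succ N =>
      rw [powRem]
      have h := ih N
      have h' := ih (N + 1)
      rw [degree_lt_iff_coeff_zero] at h h' ⊢
      intro m hm
      cases m with
      | zero => omega
      | succ m =>
        rw [sub_mul, coeff_add, coeff_sub, coeff_X_mul, coeff_C_mul, coeff_C_mul, h' _ hm,
          h m (by omega), h (m + 1) (by omega)]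
        simp

lemma eval_powRem {R : Type*} [CommRing R] (x : ℕ → R) {N i : ℕ} (hi : i < N) (M : ℕ) :
    (powRem x N M).eval (x i) = x i ^ M := by
  induction M generalizing N with
  | zero =>
    cases N with
    | zero => omega
    | succ N => simp [powRem]
  | succ M ih =>
    cases N with
    | zero => omega
    | succ N =>
      rw [powRem, eval_add, eval_mul, eval_mul, ih hi, eval_C, eval_sub, eval_X, eval_C]
      rcases Nat.lt_succ_iff_lt_or_eq.mp hi with h | rfl
      · rw [ih h]; ring
      · ring

lemma powRem_of_lt {R : Type*} [CommRing R] (x : ℕ → R) {N M : ℕ} (h : M < N) :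
    powRem x N M = X ^ M := by
  induction M generalizing N with
  | zero =>
    cases N with
    | zero => omega
    | succ N => simp [powRem]
  | succ M ih =>
    cases N with
    | zero => omega
    | succ N => rw [powRem, ih (by omega), ih (by omega)]; ring

/-- The modulus of the `j`-th coefficient of the remainder of `X ^ M` modulo `(X - 1) ^ N`, for
`N ≤ M + 1`. -/
def hookCoeff (N M j : ℕ) : ℕ :=
  if j < N then M.choose j * (M - j - 1).choose (N - j - 1) else 0

lemma hookCoeff_of_le {N M j : ℕ} (h : N ≤ j) : hookCoeff N M j = 0 := by
  simp [hookCoeff, h]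

lemma hookCoeff_self (M j : ℕ) : hookCoeff (M + 1) M j = if j = M then 1 else 0 := by
  rcases lt_trichotomy j M with h | rfl | h
  · have h1 : M - j - 1 < M + 1 - j - 1 := by omega
    simp [hookCoeff, Nat.choose_eq_zero_of_lt h1, h.ne]
  · simp [hookCoeff]
  · rw [hookCoeff_of_le h, if_neg h.ne']

/-- Coefficient `0` of the recursion for the remainders modulo `(X - 1) ^ N`, signs removed. -/
lemma hookCoeff_succ_zero {N M : ℕ} (h : N ≤ M) :
    hookCoeff (N + 1) (M + 1) 0 = hookCoeff (N + 1) M 0 + hookCoeff N M 0 := by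
  cases N with
  | zero => simp [hookCoeff]
  | succ N =>
    obtain ⟨m, rfl⟩ : ∃ m, M = m + 1 := ⟨M - 1, by omega⟩
    simp [hookCoeff, Nat.choose_succ_succ, add_comm]

/-- Coefficient `j + 1` of the recursion for the remainders modulo `(X - 1) ^ N`, signs
removed. -/
lemma hookCoeff_succ_succ {N M : ℕ} (h : N ≤ M) (j : ℕ) :
    hookCoeff (N + 1) (M + 1) (j + 1) =
      hookCoeff (N + 1) M (j + 1) + hookCoeff N M (j + 1) + hookCoeff N M j := by
  rcases lt_trichotomy (j + 1) N with hj | rfl | hj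
  · obtain ⟨n, rfl⟩ : ∃ n, N = n + j + 2 := ⟨N - (j + 2), by omega⟩
    obtain ⟨m, rfl⟩ : ∃ m, M = m + j + 2 := ⟨M - (j + 2), by omega⟩
    have e1 : m + j + 2 + 1 - (j + 1) - 1 = m + 1 := by omega
    have e2 : n + j + 2 + 1 - (j + 1) - 1 = n + 1 := by omega
    have e3 : m + j + 2 - (j + 1) - 1 = m := by omega
    have e4 : n + j + 2 - (j + 1) - 1 = n := by omega
    have e5 : m + j + 2 - j - 1 = m + 1 := by omega
    have e6 : n + j + 2 - j - 1 = n + 1 := by omega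
    have i1 : j + 1 < n + j + 2 + 1 := by omega
    have i2 : j + 1 < n + j + 2 := by omega
    have i3 : j < n + j + 2 := by omega
    simp only [hookCoeff, e1, e2, e3, e4, e5, e6, i1, i2, i3, if_true]
    rw [Nat.choose_succ_succ (m + j + 2) j, Nat.choose_succ_succ m n]
    ring
  · simp [hookCoeff, Nat.choose_succ_succ, add_comm]
  · simp [hookCoeff_of_le, show N ≤ j by omega, show N + 1 ≤ j + 1 by omega,
      show N ≤ j + 1 by omega]

lemma coeff_powRem_succ_zero {R : Type*} [CommRing R] (x : ℕ → R) (N M : ℕ) :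
    (powRem x (N + 1) (M + 1)).coeff 0 =
      x N * (powRem x (N + 1) M).coeff 0 - x N * (powRem x N M).coeff 0 := by
  simp [powRem, sub_eq_add_neg]

lemma coeff_powRem_succ_succ {R : Type*} [CommRing R] (x : ℕ → R) (N M j : ℕ) :
    (powRem x (N + 1) (M + 1)).coeff (j + 1) =
      x N * (powRem x (N + 1) M).coeff (j + 1) - x N * (powRem x N M).coeff (j + 1) +
        (powRem x N M).coeff j := by
  rw [powRem, sub_mul, coeff_add, coeff_sub, coeff_C_mul, coeff_C_mul, coeff_X_mul]
  ring

lemma hookCoeff_mul_pow_succ {R : Type*} [CommRing R] (r : R) {N M : ℕ} (h : N ≤ M + 1) (j : ℕ) :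
    r * (hookCoeff N M j * r ^ (M - j)) = hookCoeff N M j * r ^ (M + 1 - j) := by
  rcases le_or_gt j M with hj | hj
  · rw [Nat.succ_sub hj, pow_succ]; ring
  · rw [hookCoeff_of_le (by omega)]; simp

/-- Among the points `x i` of modulus at most `r`, the coefficients of the remainder of `X ^ M` are
largest when all points equal `r`. -/
lemma norm_coeff_powRem_le {r : ℝ} (x : ℕ → ℂ) (hx : ∀ i, ‖x i‖ ≤ r) {N M : ℕ} (h : N ≤ M + 1)
    (j : ℕ) : ‖(powRem x N M).coeff j‖ ≤ hookCoeff N M j * r ^ (M - j) := by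
  have hr : 0 ≤ r := (norm_nonneg _).trans (hx 0)
  rcases h.eq_or_lt with rfl | h
  · rw [powRem_of_lt x (Nat.lt_succ_self M), coeff_X_pow, hookCoeff_self]
    split_ifs with hj <;> simp [hj]
  · induction M generalizing N j with
    | zero =>
      obtain rfl : N = 0 := by omega
      simp [powRem, hookCoeff]
    | succ M ih =>
      cases N with
      | zero => simp [powRem, hookCoeff]
      | succ N =>
        have hN : N ≤ M := by omega
        have b1 : ∀ j, ‖(powRem x N M).coeff j‖ ≤ hookCoeff N M j * r ^ (M - j) :=
          fun j => ih (by omega) j (by omega)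
        have b2 : ∀ j, ‖(powRem x (N + 1) M).coeff j‖ ≤ hookCoeff (N + 1) M j * r ^ (M - j) := by
          intro j
          rcases hN.eq_or_lt with rfl | hN
          · rw [powRem_of_lt x (Nat.lt_succ_self N), coeff_X_pow, hookCoeff_self]
            split_ifs with hj <;> simp [hj]
          · exact ih (by omega) j (by omega)
        have mulb : ∀ (z : ℂ) (b : ℝ), ‖z‖ ≤ b → ‖x N * z‖ ≤ r * b := fun z b hz => by
          rw [norm_mul]
          exact mul_le_mul (hx N) hz (norm_nonneg _) hr
        cases j with
        | zero =>
          rw [coeff_powRem_succ_zero, hookCoeff_succ_zero hN]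
          refine (norm_sub_le _ _).trans ((add_le_add (mulb _ _ (b2 0)) (mulb _ _ (b1 0))).trans ?_)
          rw [hookCoeff_mul_pow_succ r (by omega), hookCoeff_mul_pow_succ r (by omega)]
          push_cast
          exact (add_mul _ _ _).ge
        | succ j =>
          rw [coeff_powRem_succ_succ, hookCoeff_succ_succ hN]
          refine (norm_add_le _ _).trans ((add_le_add ((norm_sub_le _ _).trans
            (add_le_add (mulb _ _ (b2 _)) (mulb _ _ (b1 _)))) (b1 j)).trans ?_)
          rw [hookCoeff_mul_pow_succ r (by omega), hookCoeff_mul_pow_succ r (by omega),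
            Nat.add_sub_add_right]
          push_cast
          exact le_of_eq (by ring)

/-- The remainder of `X ^ M` modulo `(X - r) ^ N`: its coefficients alternate in sign. -/
lemma coeff_powRem_const {R : Type*} [CommRing R] (r : R) {N M : ℕ} (h : N ≤ M + 1) (j : ℕ) :
    (powRem (fun _ => r) N M).coeff j =
      (-1) ^ (N + 1 + j) * (hookCoeff N M j * r ^ (M - j)) := by
  have top : ∀ M j : ℕ, (powRem (fun _ => r) (M + 1) M).coeff j =
      (-1) ^ (M + 1 + 1 + j) * (hookCoeff (M + 1) M j * r ^ (M - j)) := by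
    intro M j
    rw [powRem_of_lt _ (Nat.lt_succ_self M), coeff_X_pow, hookCoeff_self]
    split_ifs with hj
    · subst hj
      simp [Even.neg_one_pow (show Even (j + 1 + 1 + j) from ⟨j + 1, by ring⟩)]
    · simp
  induction M generalizing N j with
  | zero =>
    rcases h.eq_or_lt with rfl | h
    · exact top 0 j
    · obtain rfl : N = 0 := by omega
      simp [powRem, hookCoeff]
  | succ M ih =>
    cases N with
    | zero => simp [powRem, hookCoeff]
    | succ N =>
      rcases h.eq_or_lt with h | h
      · obtain rfl : N = M + 1 := by omega
        exact top _ j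
      · have hN : N ≤ M := by omega
        have p1 := hookCoeff_mul_pow_succ r (show N + 1 ≤ M + 1 by omega)
        have p2 := hookCoeff_mul_pow_succ r (show N ≤ M + 1 by omega)
        cases j with
        | zero =>
          rw [coeff_powRem_succ_zero, hookCoeff_succ_zero hN, ih (by omega), ih (by omega)]
          simp only [tsub_zero, add_zero]
          push_cast
          ring
        | succ j =>
          rw [coeff_powRem_succ_succ, hookCoeff_succ_succ hN, ih (by omega), ih (by omega),
            ih (by omega)]
          have p1 := p1 (j + 1)
          have p2 := p2 (j + 1)
          rw [Nat.add_sub_add_right] at p1 p2 ⊢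
          push_cast
          linear_combination (-1) ^ (N + 1 + 1 + (j + 1)) * p1 - (-1) ^ (N + 1 + (j + 1)) * p2

lemma continuous_coeff_powRem {T R : Type*} [TopologicalSpace T] [CommRing R] [TopologicalSpace R]
    [IsTopologicalRing R] {x : T → ℕ → R} (hx : ∀ i, Continuous fun t => x t i) (N M j : ℕ) :
    Continuous fun t => (powRem (x t) N M).coeff j := by
  induction M generalizing N j with
  | zero => cases N <;> simp only [powRem] <;> exact continuous_const
  | succ M ih =>
    cases N with
    | zero => simp only [powRem]; exact continuous_const
    | succ N =>
      cases j with
      | zero =>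
        simp only [coeff_powRem_succ_zero]
        exact ((hx N).mul (ih _ _)).sub ((hx N).mul (ih _ _))
      | succ j =>
        simp only [coeff_powRem_succ_succ]
        exact (((hx N).mul (ih _ _)).sub ((hx N).mul (ih _ _))).add (ih _ _)

/-- The power of a point is a combination of its first `N` powers, with coefficients that do not
depend on which of the `N` points is taken. -/
lemma pow_eq_sum_coeff_powRem {R : Type*} [CommRing R] (x : ℕ → R) {N : ℕ} (M : ℕ) (i : Fin N) :
    x i ^ M = ∑ j : Fin N, (powRem x N M).coeff j * x i ^ (j : ℕ) := by
  rw [Fin.sum_univ_eq_sum_range (fun j => (powRem x N M).coeff j * x i ^ j) N,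
    ← eval_powRem x i.2 M]
  by_cases h : powRem x N M = 0
  · simp [h]
  · exact eval_eq_sum_range' ((natDegree_lt_iff_degree_lt h).mpr (degree_powRem_lt x N M)) _

lemma criticalConstant_eq_sum_hookCoeff {N : ℕ} (c : Fin N → ℝ) {M : ℕ} {r ρ : ℝ}
    (hr : r ^ 2 = ρ) :
    criticalConstant c M ρ = ∑ j : Fin N, (hookCoeff N M j * r ^ (M - (j : ℕ))) ^ 2 / c j := by
  refine Finset.sum_congr rfl fun j _ => ?_
  rw [hookCoeff, if_pos j.2, ← hr]
  push_cast
  ring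

end PowerRemainder

/-! ### From rank one to arbitrary rank -/

section RankExtension

open Polynomial Matrix

/-- Removing from a positive semidefinite matrix the rank one matrix with the same first row and
column leaves a positive semidefinite matrix (a Schur complement bordered by zeros). -/
lemma exists_vecMulVec_first_row {N : ℕ} {A : Matrix (Fin (N + 1)) (Fin (N + 1)) ℂ}
    (hA : A.PosSemidef) :
    ∃ u : Fin (N + 1) → ℂ, (A - vecMulVec u (star u)).PosSemidef ∧
      (∀ j, (A - vecMulVec u (star u)) 0 j = 0) ∧ ∀ i, (A - vecMulVec u (star u)) i 0 = 0 := by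
  have herm : ∀ i j, star (A i j) = A j i := fun i j => hA.isHermitian.apply j i
  have ha : 0 ≤ A 0 0 := hA.diag_nonneg
  obtain ⟨s, hs, hs2⟩ : ∃ s : ℝ, 0 ≤ s ∧ (s : ℂ) ^ 2 = A 0 0 := by
    refine ⟨√(A 0 0).re, Real.sqrt_nonneg _, ?_⟩
    rw [← Complex.ofReal_pow, Real.sq_sqrt (Complex.nonneg_iff.mp ha).1]
    exact Complex.ext rfl (Complex.nonneg_iff.mp ha).2
  -- When `A 0 0 = 0` the first column vanishes, and the vector `u` below is zero since `s = 0`.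
  have hrow : ∀ i, A 0 0 = 0 → A i 0 = 0 := by
    intro i h0
    have h := (hA.dotProduct_mulVec_zero_iff (Pi.single 0 1)).mp (by simpa using h0)
    simpa using congrFun h i
  have hrow' : ∀ j, A 0 0 = 0 → A 0 j = 0 := fun j h0 => by
    rw [← herm, hrow j h0, star_zero]
  refine ⟨fun i => A i 0 / s, ?_, ?_, ?_⟩
  · have hB : ∀ i j, (A - vecMulVec (fun i => A i 0 / s) (star fun i => A i 0 / (s : ℂ))) i j =
        A i j - (A 0 0)⁻¹ * A i 0 * A 0 j := by
      intro i j
      simp only [Matrix.sub_apply, vecMulVec_apply, Pi.star_apply, star_div₀, herm, ← hs2]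
      simp only [RCLike.star_def, Complex.conj_ofReal]
      ring
    set P : Matrix (Fin (N + 1)) (Fin (N + 1)) ℂ :=
      1 - (A 0 0)⁻¹ • vecMulVec (Pi.single 0 1) (A 0) with hP
    have hAP : A * P = A - (A 0 0)⁻¹ • vecMulVec (fun i => A i 0) (A 0) := by
      rw [hP, mul_sub, mul_one, mul_smul_comm, mul_vecMulVec]
      congr 3
      ext i
      simp
    have h0 : ∀ j, (A * P) 0 j = 0 := by
      intro j
      rw [hAP]
      simp only [Matrix.sub_apply, Matrix.smul_apply, vecMulVec_apply, smul_eq_mul]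
      by_cases h : A 0 0 = 0
      · rw [h, hrow' j h]; simp
      · field_simp; simp
    have key : Pᴴ * A * P = A * P := by
      rw [mul_assoc, hP, conjTranspose_sub, conjTranspose_smul, conjTranspose_vecMulVec, ← hP,
        conjTranspose_one, sub_mul, one_mul, smul_mul_assoc, vecMulVec_mul]
      have : star (Pi.single 0 1 : Fin (N + 1) → ℂ) ᵥ* (A * P) = 0 := by
        ext j
        rw [← Pi.single_star, star_one, single_one_vecMul]
        exact h0 j
      rw [this]
      simp
    convert hA.conjTranspose_mul_mul_same P using 1
    rw [key, hAP]
    ext i j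
    rw [hB]
    simp [vecMulVec_apply, mul_assoc]
  all_goals
    intro i
    simp only [Matrix.sub_apply, vecMulVec_apply, Pi.star_apply, star_div₀, herm]
    simp only [RCLike.star_def, Complex.conj_ofReal]
    by_cases h : A 0 0 = 0
    · simp [hrow i h, hrow' i h]
    · have hs0 : (s : ℂ) ≠ 0 := fun h' => h (by rw [← hs2, h']; simp)
      rw [← hs2]
      field_simp
      simp

lemma isHermitian_map_aeval {n : Type*} {A : Matrix n n ℂ} (hA : A.IsHermitian) (f : ℝ[X]) :
    (A.map fun z => aeval z f).IsHermitian := by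
  ext i j
  rw [conjTranspose_apply, map_apply, map_apply, ← hA.apply i j]
  exact (aeval_conj f _).symm

lemma posSemidef_of_re_nonneg {n : Type*} [Fintype n] {A : Matrix n n ℂ} (hA : A.IsHermitian)
    (h : ∀ v : n → ℂ, 0 ≤ (star v ⬝ᵥ A *ᵥ v).re) : A.PosSemidef :=
  .of_dotProduct_mulVec_nonneg hA fun v =>
    Complex.nonneg_iff.mpr ⟨h v, (hA.im_star_dotProduct_mulVec_self v).symm⟩

/-- If `D` is positive semidefinite with zero first row and column, then `D ⊙ E` is positive
semidefinite as soon as the lower right block of `E` is. -/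
lemma posSemidef_hadamard_of_first_row_eq_zero {N : ℕ}
    {D E : Matrix (Fin (N + 1)) (Fin (N + 1)) ℂ} (hD : D.PosSemidef) (h0 : ∀ j, D 0 j = 0)
    (h0' : ∀ i, D i 0 = 0) (hE : (E.submatrix Fin.succ Fin.succ).PosSemidef) (v) :
    0 ≤ star v ⬝ᵥ (D ⊙ E) *ᵥ v := by
  have h := ((hD.submatrix Fin.succ).hadamard hE).dotProduct_mulVec_nonneg (v ∘ Fin.succ)
  simpa [dotProduct, mulVec, Fin.sum_univ_succ, h0, h0'] using h

/-- Passage from rank one to arbitrary rank. If `u u⋆` is the rank one matrix with the same first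
row and column as `A`, then `f[A]` is reached from `f[u u⋆]` along the segment between `u u⋆` and
`A`, on which the quadratic forms of `f[·]` are nondecreasing: their derivative is that of
`(A - u u⋆) ⊙ f'[·]`, and `A - u u⋆` is supported on the block of size `N`. -/
theorem posSemidef_map_aeval_succ {N : ℕ} {ρ : ℝ} (f : ℝ[X])
    (hrank : ∀ u : Fin (N + 1) → ℂ, (∀ i, ‖u i‖ ^ 2 ≤ ρ) →
      ((vecMulVec u (star u)).map fun z => aeval z f).PosSemidef)
    (hder : ∀ A ∈ psdMatrices N (Metric.closedBall (0 : ℂ) ρ),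
      (A.map fun z => aeval z (derivative f)).PosSemidef)
    {A : Matrix (Fin (N + 1)) (Fin (N + 1)) ℂ}
    (hA : A ∈ psdMatrices (N + 1) (Metric.closedBall (0 : ℂ) ρ)) :
    (A.map fun z => aeval z f).PosSemidef := by
  obtain ⟨hA, hAρ⟩ := hA
  obtain ⟨u, hD, h0, h0'⟩ := exists_vecMulVec_first_row hA
  set B := vecMulVec u (star u) with hB
  have hBpsd : B.PosSemidef := posSemidef_vecMulVec_self_star u
  have hu : ∀ i, ‖u i‖ ^ 2 ≤ ρ := by
    intro i
    have h1 := (Complex.nonneg_iff.mp (hD.diag_nonneg (i := i))).1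
    have h2 : (B i i).re = ‖u i‖ ^ 2 := by
      simp only [hB, vecMulVec_apply, Pi.star_apply, RCLike.star_def, Complex.mul_conj,
        Complex.normSq_eq_norm_sq, Complex.ofReal_re]
    have h3 := (Complex.re_le_norm _).trans (mem_closedBall_zero_iff.mp (hAρ i i))
    rw [Matrix.sub_apply, Complex.sub_re, h2] at h1
    linarith
  have hBρ : ∀ i j, ‖B i j‖ ≤ ρ := by
    intro i j
    rw [hB, vecMulVec_apply, norm_mul, Pi.star_apply, norm_star]
    nlinarith [hu i, hu j, sq_nonneg (‖u i‖ - ‖u j‖)]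
  refine posSemidef_of_re_nonneg (isHermitian_map_aeval hA.isHermitian f) fun v => ?_
  set F : ℝ → Matrix (Fin (N + 1)) (Fin (N + 1)) ℂ := fun t => B + (t : ℂ) • (A - B) with hF
  have hFder : ∀ t, 0 ≤ t → t ≤ 1 →
      (((F t).map fun z => aeval z (derivative f)).submatrix Fin.succ Fin.succ).PosSemidef := by
    intro t ht0 ht1
    have hFt : F t = (1 - t) • B + t • A := by
      ext i j
      simp [hF]
      ring
    have hpsd : (F t).PosSemidef := by
      rw [hFt]
      exact (hBpsd.smul (sub_nonneg.mpr ht1)).add (hA.smul ht0)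
    refine hder ((F t).submatrix Fin.succ Fin.succ) ⟨hpsd.submatrix _, fun i j => ?_⟩
    rw [hFt]
    exact convex_closedBall (0 : ℂ) ρ (mem_closedBall_zero_iff.mpr (hBρ _ _)) (hAρ _ _)
      (sub_nonneg.mpr ht1) ht0 (sub_add_cancel 1 t)
  set q : ℝ → ℝ := fun t => (star v ⬝ᵥ ((F t).map fun z => aeval z f) *ᵥ v).re with hq
  have hq' : ∀ t, HasDerivAt q
      (star v ⬝ᵥ ((A - B) ⊙ (F t).map fun z => aeval z (derivative f)) *ᵥ v).re t := by
    intro t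
    have hentry : ∀ i j, HasDerivAt (fun s : ℝ => aeval (F s i j) f)
        (aeval (F t i j) (derivative f) * (A - B) i j) t := by
      intro i j
      have h1 : HasDerivAt (fun s : ℂ => B i j + s * (A - B) i j) ((A - B) i j) (t : ℂ) := by
        simpa using ((hasDerivAt_id (t : ℂ)).mul_const ((A - B) i j)).const_add (B i j)
      exact ((f.hasDerivAt_aeval _).comp (t : ℂ) h1).comp_ofReal
    have hsum : HasDerivAt (fun s : ℝ => star v ⬝ᵥ ((F s).map fun z => aeval z f) *ᵥ v)
        (star v ⬝ᵥ ((A - B) ⊙ (F t).map fun z => aeval z (derivative f)) *ᵥ v) t := by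
      simp only [dotProduct, mulVec, hadamard_apply, map_apply]
      refine HasDerivAt.fun_sum fun i _ => HasDerivAt.const_mul _ (HasDerivAt.fun_sum fun j _ =>
        HasDerivAt.mul_const ?_ _)
      rw [mul_comm]
      exact hentry i j
    exact Complex.reCLM.hasFDerivAt.comp_hasDerivAt t hsum
  have hmono : MonotoneOn q (Set.Icc 0 1) := by
    refine monotoneOn_of_deriv_nonneg (convex_Icc 0 1)
      (fun t _ => (hq' t).continuousAt.continuousWithinAt)
      (fun t _ => (hq' t).differentiableAt.differentiableWithinAt) fun t ht => ?_
    rw [interior_Icc] at ht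
    rw [(hq' t).deriv]
    exact (Complex.nonneg_iff.mp (posSemidef_hadamard_of_first_row_eq_zero hD h0 h0'
      (hFder t ht.1.le ht.2.le) v)).1
  have h01 := hmono (Set.left_mem_Icc.mpr zero_le_one) (Set.right_mem_Icc.mpr zero_le_one)
    zero_le_one
  have hq0 : 0 ≤ q 0 := by
    simpa [hq, hF] using (Complex.nonneg_iff.mp ((hrank u hu).dotProduct_mulVec_nonneg v)).1
  simpa [hq, hF] using hq0.trans h01

end RankExtension

/-! ### The inequality in rank one -/

section RankOne

open Matrix

/-- The quadratic form of a Hadamard power of a rank one matrix. -/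
lemma dotProduct_hadamardPower_vecMulVec {N : ℕ} (u v : Fin N → ℂ) (k : ℕ) :
    star v ⬝ᵥ hadamardPower (vecMulVec u (star u)) k *ᵥ v =
      ((‖∑ i, star (v i) * u i ^ k‖ ^ 2 : ℝ) : ℂ) := by
  rw [← Complex.normSq_eq_norm_sq, ← Complex.mul_conj, map_sum, Finset.sum_mul_sum]
  simp only [dotProduct, mulVec, hadamardPower, map_apply, vecMulVec_apply, Finset.mul_sum]
  refine Finset.sum_congr rfl fun i _ => Finset.sum_congr rfl fun j _ => ?_
  simp
  ring

lemma dotProduct_hadamardCombination_vecMulVec {N : ℕ} (c : Fin N → ℝ) (u v : Fin N → ℂ) :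
    star v ⬝ᵥ hadamardCombination c (vecMulVec u (star u)) *ᵥ v =
      ((∑ j, c j * ‖∑ i, star (v i) * u i ^ (j : ℕ)‖ ^ 2 : ℝ) : ℂ) := by
  rw [hadamardCombination, sum_mulVec, dotProduct_sum, Complex.ofReal_sum]
  refine Finset.sum_congr rfl fun j _ => ?_
  rw [smul_mulVec, dotProduct_smul, dotProduct_hadamardPower_vecMulVec, Complex.real_smul,
    Complex.ofReal_mul]

lemma isHermitian_hadamardPower {N : ℕ} {A : Matrix (Fin N) (Fin N) ℂ} (hA : A.IsHermitian)
    (k : ℕ) : (hadamardPower A k).IsHermitian := by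
  ext i j
  simp [hadamardPower, ← hA.apply i j]

lemma isHermitian_hadamardCombination {N : ℕ} (c : Fin N → ℝ) {A : Matrix (Fin N) (Fin N) ℂ}
    (hA : A.IsHermitian) : (hadamardCombination c A).IsHermitian := by
  ext i j
  simp [hadamardCombination, Matrix.sum_apply, hadamardPower, ← hA.apply i j]

/-- The Cauchy-Schwarz inequality with weights. -/
lemma norm_sq_sum_mul_le {ι : Type*} (s : Finset ι) {c : ι → ℝ} (hc : ∀ j, 0 < c j)
    (p L : ι → ℂ) :
    ‖∑ j ∈ s, p j * L j‖ ^ 2 ≤ (∑ j ∈ s, ‖p j‖ ^ 2 / c j) * ∑ j ∈ s, c j * ‖L j‖ ^ 2 := by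
  have h1 : ‖∑ j ∈ s, p j * L j‖ ≤ ∑ j ∈ s, ‖p j‖ * ‖L j‖ :=
    (norm_sum_le _ _).trans_eq (Finset.sum_congr rfl fun _ _ => norm_mul _ _)
  refine (pow_le_pow_left₀ (norm_nonneg _) h1 2).trans ?_
  refine Finset.sum_sq_le_sum_mul_sum_of_sq_le_mul s (fun j _ => div_nonneg (sq_nonneg _) (hc j).le)
    (fun j _ => mul_nonneg (hc j).le (sq_nonneg _)) fun j _ => le_of_eq ?_
  have := (hc j).ne'
  field_simp

lemma criticalConstant_pos {N M : ℕ} (hN : 1 ≤ N) (hMN : N ≤ M) {c : Fin N → ℝ}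
    (hc : ∀ j, 0 < c j) {ρ : ℝ} (hρ : 0 < ρ) : 0 < criticalConstant c M ρ := by
  refine Finset.sum_pos (fun j _ => ?_) ⟨⟨0, hN⟩, Finset.mem_univ _⟩
  have h1 : 0 < M.choose j := Nat.choose_pos (by omega)
  have h2 : 0 < (M - (j : ℕ) - 1).choose (N - (j : ℕ) - 1) := Nat.choose_pos (by omega)
  have := hc j
  positivity

/-- The inequality for matrices of rank one, for every constant that is at least the critical one. -/
lemma posSemidef_rankOne {N M : ℕ} (hMN : N ≤ M) {c : Fin N → ℝ} (hc : ∀ j, 0 < c j) {ρ K : ℝ}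
    (hρ : 0 ≤ ρ) (hK : criticalConstant c M ρ ≤ K) (u : Fin N → ℂ) (hu : ∀ i, ‖u i‖ ^ 2 ≤ ρ) :
    (K • hadamardCombination c (vecMulVec u (star u)) -
      hadamardPower (vecMulVec u (star u)) M).PosSemidef := by
  have hherm : (vecMulVec u (star u)).IsHermitian := (posSemidef_vecMulVec_self_star u).isHermitian
  refine posSemidef_of_re_nonneg (((isHermitian_hadamardCombination c hherm).smul
    (IsSelfAdjoint.all K)).sub (isHermitian_hadamardPower hherm M)) fun v => ?_
  set x : ℕ → ℂ := fun i => if h : i < N then u ⟨i, h⟩ else 0 with hx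
  have hxu : ∀ i : Fin N, x i = u i := fun i => by simp [hx]
  have hxρ : ∀ i, ‖x i‖ ≤ √ρ := by
    intro i
    simp only [hx]
    split_ifs with h
    · exact Real.le_sqrt_of_sq_le (hu _)
    · simp
  set L : ℕ → ℂ := fun k => ∑ i, star (v i) * u i ^ k with hL
  have hLM : L M = ∑ j : Fin N, (powRem x N M).coeff j * L j := by
    simp only [hL, Finset.mul_sum]
    rw [Finset.sum_comm]
    refine Finset.sum_congr rfl fun i _ => ?_
    rw [← hxu i, pow_eq_sum_coeff_powRem x M i, Finset.mul_sum]
    refine Finset.sum_congr rfl fun j _ => ?_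
    ring
  have hS : 0 ≤ ∑ j : Fin N, c j * ‖L j‖ ^ 2 :=
    Finset.sum_nonneg fun j _ => mul_nonneg (hc j).le (sq_nonneg _)
  have hcoef : ∑ j : Fin N, ‖(powRem x N M).coeff j‖ ^ 2 / c j ≤ K := by
    rw [criticalConstant_eq_sum_hookCoeff c (Real.sq_sqrt hρ)] at hK
    refine (Finset.sum_le_sum fun j _ => ?_).trans hK
    have := norm_coeff_powRem_le x hxρ (show N ≤ M + 1 by omega) j
    have := (hc j).le
    gcongr
  have hmain := (norm_sq_sum_mul_le Finset.univ hc (fun j : Fin N => (powRem x N M).coeff j)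
    fun j => L j).trans (mul_le_mul_of_nonneg_right hcoef hS)
  rw [← hLM] at hmain
  rw [sub_mulVec, dotProduct_sub, smul_mulVec, dotProduct_smul,
    dotProduct_hadamardCombination_vecMulVec, dotProduct_hadamardPower_vecMulVec, Complex.sub_re,
    Complex.real_smul, ← Complex.ofReal_mul, Complex.ofReal_re, Complex.ofReal_re]
  exact sub_nonneg.mpr hmain

end RankOne

/-! ### Sharpness of the constant -/

section Sharpness

open Matrix

/-- For distinct points `x i`, the weighted power sums `∑ i, star (v i) * x i ^ j` with `j < N` can
be prescribed freely. Testing a constant `t` that is admissible for the rank one matrix generated by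
the points on the extremal choice bounds the sum of squares of the remainder coefficients. -/
lemma sq_sum_norm_coeff_le {N M : ℕ} {c : Fin N → ℝ} (hc : ∀ j, 0 < c j) {t : ℝ} (x : ℕ → ℂ)
    (hx : Function.Injective fun i : Fin N => x i)
    (ht : hadamardPower (vecMulVec (fun i : Fin N => x i) (star fun i : Fin N => x i)) M ≤
      t • hadamardCombination c (vecMulVec (fun i : Fin N => x i) (star fun i : Fin N => x i))) :
    (∑ j : Fin N, ‖(powRem x N M).coeff j‖ ^ 2 / c j) ^ 2 ≤
      t * ∑ j : Fin N, ‖(powRem x N M).coeff j‖ ^ 2 / c j := by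
  set p : Fin N → ℂ := fun j => (powRem x N M).coeff j with hp
  set u : Fin N → ℂ := fun i => x i with hu
  -- Equality in the Cauchy-Schwarz inequality requires power sums proportional to `conj p j / c j`.
  obtain ⟨w, hw⟩ : ∃ w : Fin N → ℂ, w ᵥ* vandermonde u = fun j => star (p j) / c j := by
    have hdet : IsUnit (vandermonde u).det :=
      isUnit_iff_ne_zero.mpr (det_vandermonde_ne_zero_iff.mpr hx)
    refine ⟨(fun j => star (p j) / c j) ᵥ* (vandermonde u)⁻¹, ?_⟩
    rw [vecMul_vecMul, nonsing_inv_mul _ hdet, vecMul_one]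
  have hwj : ∀ j : Fin N, ∑ i, w i * u i ^ (j : ℕ) = star (p j) / c j := fun j => congrFun hw j
  have hL : ∀ j : Fin N, c j * ‖∑ i, star (star w i) * u i ^ (j : ℕ)‖ ^ 2 = ‖p j‖ ^ 2 / c j := by
    intro j
    simp only [Pi.star_apply, star_star]
    have := (hc j).ne'
    rw [hwj, norm_div, norm_star, Complex.norm_real, Real.norm_of_nonneg (hc j).le]
    field_simp
  have hLM : ∑ i, star (star w i) * u i ^ M = ((∑ j, ‖p j‖ ^ 2 / c j : ℝ) : ℂ) := by
    have : ∀ i, star (star w i) * u i ^ M = ∑ j : Fin N, p j * (w i * u i ^ (j : ℕ)) := by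
      intro i
      rw [Pi.star_apply, star_star, hu, pow_eq_sum_coeff_powRem x M i, Finset.mul_sum]
      exact Finset.sum_congr rfl fun j _ => by ring
    rw [Finset.sum_congr rfl fun i _ => this i, Finset.sum_comm, Complex.ofReal_sum]
    refine Finset.sum_congr rfl fun j _ => ?_
    rw [← Finset.mul_sum, hwj, ← Complex.normSq_eq_norm_sq, Complex.ofReal_div, ← Complex.mul_conj,
      mul_div_assoc]
    rfl
  have h := (Complex.nonneg_iff.mp
    ((Matrix.le_iff.mp ht).dotProduct_mulVec_nonneg (star w))).1
  rw [sub_mulVec, dotProduct_sub, smul_mulVec, dotProduct_smul,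
    dotProduct_hadamardCombination_vecMulVec, dotProduct_hadamardPower_vecMulVec, Complex.sub_re,
    Complex.real_smul, ← Complex.ofReal_mul, Complex.ofReal_re, Complex.ofReal_re, hLM,
    Finset.sum_congr rfl fun j _ => hL j, Complex.norm_real, Real.norm_eq_abs, sq_abs] at h
  linarith

/-- Any admissible constant is at least the critical one: test it on rank one matrices whose
generating points are distinct and tend to `√ρ`. -/
lemma criticalConstant_le {ρ : ℝ} (hρ : 0 < ρ) {N M : ℕ} (hN : 1 ≤ N) (hMN : N ≤ M)
    {c : Fin N → ℝ} (hc : ∀ j, 0 < c j) {t : ℝ}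
    (ht : ∀ A ∈ psdMatrices N (Metric.closedBall (0 : ℂ) ρ),
      hadamardPower A M ≤ t • hadamardCombination c A) :
    criticalConstant c M ρ ≤ t := by
  set x : ℝ → ℕ → ℂ := fun ε i => ((√ρ * (1 - ε * i) : ℝ) : ℂ) with hx
  set S : ℝ → ℝ := fun ε => ∑ j : Fin N, ‖(powRem (x ε) N M).coeff j‖ ^ 2 / c j with hS
  have hcont : Continuous S := by
    refine continuous_finsetSum _ fun j _ => ((Continuous.norm
      (continuous_coeff_powRem (fun i => ?_) N M j)).pow 2).div_const _
    exact Complex.continuous_ofReal.comp (by fun_prop)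
  have hS0 : S 0 = criticalConstant c M ρ := by
    rw [criticalConstant_eq_sum_hookCoeff c (Real.sq_sqrt hρ.le)]
    refine Finset.sum_congr rfl fun j _ => ?_
    have : x 0 = fun _ => ((√ρ : ℝ) : ℂ) := by ext i; simp [hx]
    rw [this, coeff_powRem_const _ (by omega)]
    simp [abs_of_nonneg]
  have hev : ∀ᶠ ε in nhdsWithin (0 : ℝ) (Set.Ioi 0), S ε ^ 2 ≤ t * S ε := by
    have hNpos : (0 : ℝ) < N := by exact_mod_cast hN
    filter_upwards [Ioo_mem_nhdsGT (show (0 : ℝ) < 1 / N by positivity)] with ε hε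
    have hεN : ε * N ≤ 1 := by
      have := hε.2.le
      rwa [le_div_iff₀ hNpos] at this
    have hxle : ∀ i : Fin N, ‖x ε i‖ ≤ √ρ := by
      intro i
      have h1 : ε * (i : ℕ) ≤ ε * N :=
        mul_le_mul_of_nonneg_left (by exact_mod_cast i.2.le) hε.1.le
      have h2 : 0 ≤ ε * (i : ℕ) := mul_nonneg hε.1.le (Nat.cast_nonneg _)
      rw [hx, Complex.norm_real, Real.norm_of_nonneg
        (mul_nonneg (Real.sqrt_nonneg _) (by linarith))]
      exact mul_le_of_le_one_right (Real.sqrt_nonneg _) (by linarith)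
    refine sq_sum_norm_coeff_le hc (x ε) (fun i j hij => ?_) (ht _
      ⟨posSemidef_vecMulVec_self_star _, fun i j => mem_closedBall_zero_iff.mpr ?_⟩)
    · have h1 : √ρ * (1 - ε * (i : ℕ)) = √ρ * (1 - ε * (j : ℕ)) := Complex.ofReal_injective hij
      have h2 := mul_left_cancel₀ (Real.sqrt_pos.mpr hρ).ne' h1
      have h3 : ε * ((i : ℕ) : ℝ) = ε * (j : ℕ) := by linarith
      exact Fin.ext (by exact_mod_cast mul_left_cancel₀ hε.1.ne' h3)
    · rw [vecMulVec_apply, norm_mul, Pi.star_apply, norm_star]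
      exact (mul_le_mul (hxle i) (hxle j) (norm_nonneg _) (Real.sqrt_nonneg _)).trans_eq
        (Real.mul_self_sqrt hρ.le)
  have hlim : Filter.Tendsto S (nhdsWithin 0 (Set.Ioi 0)) (nhds (criticalConstant c M ρ)) := by
    rw [← hS0]
    exact hcont.continuousAt.continuousWithinAt
  have hle := le_of_tendsto_of_tendsto (hlim.pow 2) (hlim.const_mul t) hev
  rw [sq] at hle
  exact le_of_mul_le_mul_right hle (criticalConstant_pos hN hMN hc hρ)

end Sharpness

/-! ### Induction on the size of the matrices -/

section Induction

open Polynomial Matrix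

lemma map_aeval_criticalPolynomial {N : ℕ} (c : Fin N → ℝ) (M : ℕ) (K : ℝ)
    (A : Matrix (Fin N) (Fin N) ℂ) :
    (A.map fun z => aeval z (C K * ∑ j : Fin N, C (c j) * X ^ (j : ℕ) - X ^ M)) =
      K • hadamardCombination c A - hadamardPower A M := by
  ext i j
  simp [hadamardCombination, hadamardPower, Matrix.sum_apply]

/-- The derivative of `K (c₀ + ⋯ + c_N z ^ N) - z ^ (M + 1)` is `M + 1` times a polynomial of the
same shape in degree one less, with coefficients `(j + 1) c_{j+1} / (M + 1)`. -/
lemma derivative_criticalPolynomial {N : ℕ} (c : Fin (N + 1) → ℝ) (M : ℕ) (K : ℝ) :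
    derivative (C K * ∑ j : Fin (N + 1), C (c j) * X ^ (j : ℕ) - X ^ (M + 1)) =
      C ((M : ℝ) + 1) * (C K * ∑ j : Fin N,
        C (((j : ℕ) + 1) / ((M : ℝ) + 1) * c j.succ) * X ^ (j : ℕ) - X ^ M) := by
  have hM : ((M : ℝ) + 1) ≠ 0 := by positivity
  have hterm : ∀ j : Fin N, derivative (C (c j.succ) * X ^ (j.succ : ℕ)) =
      C ((M : ℝ) + 1) * (C (((j : ℕ) + 1) / ((M : ℝ) + 1) * c j.succ) * X ^ (j : ℕ)) := by
    intro j
    rw [derivative_C_mul_X_pow, ← mul_assoc, ← C_mul, Fin.val_succ, Nat.add_sub_cancel]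
    congr 2
    push_cast
    field_simp
  have hzero : derivative (C (c 0) * X ^ ((0 : Fin (N + 1)) : ℕ)) = 0 := by simp
  have hlast : derivative (X ^ (M + 1) : ℝ[X]) = C ((M : ℝ) + 1) * X ^ M := by
    rw [derivative_X_pow, Nat.add_sub_cancel]
    push_cast
    rfl
  rw [derivative_sub, derivative_C_mul, Fin.sum_univ_succ, derivative_add, derivative_sum, hzero,
    zero_add, hlast, mul_sub, mul_left_comm, Finset.sum_congr rfl fun j _ => hterm j,
    ← Finset.mul_sum]

/-- The critical constant for the derivative is at most the critical constant: by the absorption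
identity `(M + 1) binom(M, j) = (j + 1) binom(M + 1, j + 1)`, each of its terms is
`(j + 1) / (M + 1)` times a term of the latter. -/
lemma criticalConstant_derivative_le {N M : ℕ} (hMN : N ≤ M) {c : Fin (N + 1) → ℝ}
    (hc : ∀ j, 0 < c j) {ρ : ℝ} (hρ : 0 ≤ ρ) :
    criticalConstant (fun j : Fin N => ((j : ℕ) + 1) / ((M : ℝ) + 1) * c j.succ) M ρ ≤
      criticalConstant c (M + 1) ρ := by
  rw [criticalConstant, criticalConstant, Fin.sum_univ_succ]
  refine le_add_of_nonneg_of_le ?_ (Finset.sum_le_sum fun j _ => ?_)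
  · have := (hc 0).le
    positivity
  · have hcj := hc j.succ
    have habs : ((M + 1).choose ((j : ℕ) + 1) : ℝ) * ((j : ℕ) + 1) =
        ((M : ℝ) + 1) * M.choose j := by
      exact_mod_cast (Nat.add_one_mul_choose_eq M j).symm
    have hjM : ((j : ℕ) : ℝ) ≤ M := by exact_mod_cast (show (j : ℕ) ≤ M by omega)
    have hM : (0 : ℝ) < (M : ℝ) + 1 := by positivity
    have hj : (0 : ℝ) < ((j : ℕ) : ℝ) + 1 := by positivity
    rw [Fin.val_succ, Nat.add_sub_add_right, Nat.add_sub_add_right]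
    set a : ℝ := (M.choose j : ℝ)
    set b : ℝ := ((M + 1).choose ((j : ℕ) + 1) : ℝ)
    set d : ℝ := ((M - (j : ℕ) - 1).choose (N - (j : ℕ) - 1) : ℝ)
    have ha : a = b * ((j : ℕ) + 1) / (M + 1) := by
      field_simp
      linarith
    have hratio : (((j : ℕ) : ℝ) + 1) / (M + 1) ≤ 1 := (div_le_one hM).mpr (by linarith)
    have hE : a ^ 2 * d ^ 2 * (ρ ^ (M - (j : ℕ)) / ((((j : ℕ) : ℝ) + 1) / (M + 1) * c j.succ)) =
        (((j : ℕ) : ℝ) + 1) / (M + 1) * (b ^ 2 * d ^ 2 * (ρ ^ (M - (j : ℕ)) / c j.succ)) := by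
      rw [ha]
      field_simp
    rw [hE]
    exact mul_le_of_le_one_left (by positivity) hratio

/-- The inequality for matrices of arbitrary rank, by induction on the size. -/
lemma posSemidef_of_criticalConstant_le {ρ : ℝ} (hρ : 0 ≤ ρ) {N M : ℕ} (hMN : N ≤ M)
    {c : Fin N → ℝ} (hc : ∀ j, 0 < c j) {K : ℝ} (hK : criticalConstant c M ρ ≤ K)
    {A : Matrix (Fin N) (Fin N) ℂ} (hA : A ∈ psdMatrices N (Metric.closedBall (0 : ℂ) ρ)) :
    (K • hadamardCombination c A - hadamardPower A M).PosSemidef := by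
  induction N generalizing M with
  | zero =>
    rw [Subsingleton.elim (K • hadamardCombination c A - hadamardPower A M) 0]
    exact PosSemidef.zero
  | succ N ih =>
    obtain ⟨m, rfl⟩ : ∃ m, M = m + 1 := ⟨M - 1, by omega⟩
    have hNm : N ≤ m := by omega
    rw [← map_aeval_criticalPolynomial]
    refine posSemidef_map_aeval_succ _ (fun u hu => ?_) (fun B hB => ?_) hA
    · rw [map_aeval_criticalPolynomial]
      exact posSemidef_rankOne hMN hc hρ hK u hu
    · have h := (ih hNm (c := fun j : Fin N => ((j : ℕ) + 1) / ((m : ℝ) + 1) * c j.succ)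
        (fun j => mul_pos (by positivity) (hc _))
        ((criticalConstant_derivative_le hNm hc hρ).trans hK) hB).smul
          (show (0 : ℝ) ≤ (m : ℝ) + 1 by positivity)
      rw [← map_aeval_criticalPolynomial] at h
      convert h using 1
      ext i j
      rw [derivative_criticalPolynomial]
      simp

end Induction

theorem theorem3p1 (ρ : ℝ) (hρ : 0 < ρ) (M N : ℕ) (hN : 1 ≤ N) (hMN : N ≤ M)
    (c : Fin N → ℝ) (hc : ∀ j, 0 < c j) :
    (∀ A ∈ psdMatrices N (Metric.closedBall (0 : ℂ) ρ),
      hadamardPower A M ≤ criticalConstant c M ρ • hadamardCombination c A) ∧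
    (∀ t : ℝ,
      (∀ A ∈ psdMatrices N (Metric.closedBall (0 : ℂ) ρ),
        hadamardPower A M ≤ t • hadamardCombination c A) →
      criticalConstant c M ρ ≤ t) :=
  ⟨fun _ hA => Matrix.le_iff.mpr (posSemidef_of_criticalConstant_le hρ.le hMN hc le_rfl hA),
    fun _ ht => criticalConstant_le hρ hN hMN hc ht⟩
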